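/- Let $H$ be a real or complex Hilbert space and let $A\subseteq\mathcal{B}(H)$ be a C$^*$-algebra (a norm-closed $*$-subalgebra, not necessarily containing the identity operator) of real rank zero, i.e. the invertible self-adjoint elements of $A$ (with a unit adjoined, if $A$ has none) are norm dense in the self-adjoint elements. Let $\mathcal{P}(A)$ be the set of projections in $A$, with the order $P\leq Q\Leftrightarrow PQ=P$ (equivalently, $Q-P$ is positive), and, for a set or sequence of projections on $H$, let $\bigwedge$ denote its greatest lower bound in $\mathcal{P}(\mathcal{B}(H))$. Then for every sequence $(P_n)_{n\in\omega}$ in $\mathcal{P}(A)$ there is a (possibly non-strictly) decreasing sequence $(Q_n)_{n\in\omega}$ in $\mathcal{P}(A)$ with $\bigwedge_n P_n=\bigwedge_n Q_n$; in particular $(P_n)$ and $(Q_n)$ have exactly the same lower bounds in $\mathcal{P}(A)$. If moreover $\mathcal{P}(A)$ is $\sigma$-closed (every decreasing sequence of non-zero elements of $\mathcal{P}(A)$ has a non-zero lower bound in $\mathcal{P}(A)$) and $(P_n)$ has a greatest lower bound $Q$ in $\mathcal{P}(A)$, then $Q=P_0\wedge\dots\wedge P_m$ for some $m\in\omega$.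 -/

import Mathlib

namespace RealRankZero

variable {𝕜 : Type*} [RCLike 𝕜] {H : Type*} [NormedAddCommGroup H] [InnerProductSpace 𝕜 H]
  [CompleteSpace H]

/-- `e` is a (two-sided) unit of the operator algebra `A`; it need not be the identity of `H`. -/
def IsUnitOf (A : NonUnitalStarSubalgebra 𝕜 (H →L[𝕜] H)) (e : H →L[𝕜] H) : Prop :=
  e ∈ A ∧ ∀ a ∈ A, e * a = a ∧ a * e = a

/-- The operators `S + c • 1` with `S ∈ A`. When `A` is norm closed and has no unit, the sum is
direct and this is the C*-algebra obtained from `A` by adjoining a unit. -/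
def adjoinOne (A : NonUnitalStarSubalgebra 𝕜 (H →L[𝕜] H)) : Set (H →L[𝕜] H) :=
  {T | ∃ S ∈ A, ∃ c : 𝕜, T = S + c • (1 : H →L[𝕜] H)}

/-- In the algebra `B` with unit `e`, the invertible self-adjoint elements are norm dense in the
self-adjoint elements. -/
def SelfAdjointInvertiblesDense (B : Set (H →L[𝕜] H)) (e : H →L[𝕜] H) : Prop :=
  {S | S ∈ B ∧ IsSelfAdjoint S} ⊆
    closure {T | (T ∈ B ∧ IsSelfAdjoint T) ∧ ∃ T' ∈ B, T * T' = e ∧ T' * T = e}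

/-- Real rank zero: the self-adjoint invertible elements of `A` (with a unit adjoined, if `A` has
none) are dense in the self-adjoint elements. -/
def IsRealRankZero (A : NonUnitalStarSubalgebra 𝕜 (H →L[𝕜] H)) : Prop :=
  (∀ e, IsUnitOf A e → SelfAdjointInvertiblesDense (A : Set (H →L[𝕜] H)) e) ∧
    ((¬ ∃ e, IsUnitOf A e) → SelfAdjointInvertiblesDense (adjoinOne A) 1)

/-- The projections in `A`, with the order `P ≤ Q` iff `Q - P` is a positive operator. -/
abbrev Proj (A : NonUnitalStarSubalgebra 𝕜 (H →L[𝕜] H)) : Type _ :=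
  {P : H →L[𝕜] H // P ∈ A ∧ IsStarProjection P}

/-- The zero projection is the minimum of the projections in `A`. -/
instance Proj.instOrderBot (A : NonUnitalStarSubalgebra 𝕜 (H →L[𝕜] H)) : OrderBot (Proj A) where
  bot := ⟨0, A.zero_mem, IsStarProjection.zero _⟩
  bot_le P := by
    change (0 : H →L[𝕜] H) ≤ P.1
    rw [ContinuousLinearMap.nonneg_iff_isPositive]
    exact ContinuousLinearMap.IsPositive.of_isStarProjection P.2.2

/-- A projection in `A`, regarded as a projection in the algebra of all bounded operators. -/
def Proj.toAll {A : NonUnitalStarSubalgebra 𝕜 (H →L[𝕜] H)} (P : Proj A) :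
    Proj (⊤ : NonUnitalStarSubalgebra 𝕜 (H →L[𝕜] H)) :=
  ⟨P.1, NonUnitalStarAlgebra.mem_top, P.2.2⟩

/-- Every decreasing sequence of non-zero elements has a non-zero lower bound. -/
def SigmaClosed (α : Type*) [PartialOrder α] [OrderBot α] : Prop :=
  ∀ p : ℕ → α, Antitone p → (∀ n, p n ≠ ⊥) → ∃ r : α, r ≠ ⊥ ∧ ∀ n, r ≤ p n

end RealRankZero

namespace RealRankZero

open RCLike ContinuousLinearMap Filter Topology

/-! Average the projections: `T = ∑ 2⁻ⁿ⁻¹ Pₙ` is a contraction in `A` whose fixed vectors are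
exactly those common to all `Pₙ`. It remains to approach the eigenprojection of `T` at `1` from
above by projections in `A`. With `D = 1 - T`, cutoff functions of `D` at thresholds decreasing to
`0` do this approximately (`exists_cutoffs`), and real rank zero allows a projection to be inserted
between successive cutoffs (`exists_interpolation`). These projections decrease, and lie in `A`
because `T` is nearly the identity on their ranges (`exists_antitone_projections`). For the last
claim, σ-closedness forces `Qₙ = G` for some `n`, where `G` is the infimum
(`exists_eq_of_isGLB_of_antitone`). Then `1 - T ≥ δ > 0` on the kernel of `G`, whereas `1 - T ≤
2⁻ᵐ⁻¹` as a form on the common range of `P₀, …, Pₘ`. For large `m` that range must be the range of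
`G`. The functional calculus used is built over both scalar fields from an iterated square root. -/

/-! ### Square roots and absolute values. -/

/-- Solution of `2y = x + y²` by iteration: `1 - y` is then a square root of `1 - x`. -/
theorem exists_two_smul_eq_add_mul_self {𝕜 R : Type*} [RCLike 𝕜] [NormedRing R]
    [NormedAlgebra 𝕜 R] [CompleteSpace R] (x : R) (hx : ‖x‖ ≤ 1) :
    ∃ y : R, ‖y‖ ≤ 1 ∧ (2 : 𝕜) • y = x + y * y ∧
      ∀ s : Set R, IsClosed s → (0 : R) ∈ s →
        (∀ z ∈ s, (2⁻¹ : 𝕜) • (x + z * z) ∈ s) → y ∈ s := by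
  let F : R → R := fun z => (2⁻¹ : 𝕜) • (x + z * z)
  let y : ℕ → R := fun n => F^[n] 0
  -- Scalar majorant: the same iteration with `x` replaced by `1`. Its increments telescope to at
  -- most `1`, which gives convergence even for `‖x‖ = 1`, where `F` need not be a strict
  -- contraction.
  let G : ℝ → ℝ := fun z => 2⁻¹ * (1 + z * z)
  let η : ℕ → ℝ := fun n => G^[n] 0
  have hy0 : y 0 = 0 := rfl
  have hη0 : η 0 = 0 := rfl
  have hys : ∀ n, y (n + 1) = (2⁻¹ : 𝕜) • (x + y n * y n) := fun n =>
    Function.iterate_succ_apply' F n 0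
  have hηs : ∀ n, η (n + 1) = 2⁻¹ * (1 + η n * η n) := fun n =>
    Function.iterate_succ_apply' G n 0
  have h2 : ‖(2⁻¹ : 𝕜)‖ = 2⁻¹ := by simp
  have hη : ∀ n, 0 ≤ η n ∧ η n ≤ 1 := by
    intro n
    induction n with
    | zero => simp [hη0]
    | succ n ih => rw [hηs]; constructor <;> nlinarith [ih.1, ih.2]
  have hyn : ∀ n, ‖y n‖ ≤ η n := by
    intro n
    induction n with
    | zero => simp [hη0, hy0]
    | succ n ih =>
      rw [hys, hηs, norm_smul, h2]
      gcongr
      refine (norm_add_le _ _).trans ?_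
      gcongr
      exact (norm_mul_le _ _).trans (by gcongr; exact (hη n).1)
  have hd : ∀ n, ‖y (n + 1) - y n‖ ≤ η (n + 1) - η n := by
    intro n
    induction n with
    | zero =>
      rw [hys, hηs, hy0, hη0]
      simp only [mul_zero, add_zero, sub_zero, norm_smul, h2]
      linarith
    | succ n ih =>
      have e1 : y (n + 2) - y (n + 1) = (2⁻¹ : 𝕜) •
          (y (n + 1) * (y (n + 1) - y n) + (y (n + 1) - y n) * y n) := by
        calc y (n + 2) - y (n + 1) = (2⁻¹ : 𝕜) • (x + y (n + 1) * y (n + 1)) -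
              (2⁻¹ : 𝕜) • (x + y n * y n) := by rw [← hys, ← hys]
          _ = _ := by
            rw [← smul_sub]
            congr 1
            noncomm_ring
      have e2 : η (n + 2) - η (n + 1) = 2⁻¹ *
          (η (n + 1) * (η (n + 1) - η n) + (η (n + 1) - η n) * η n) := by
        calc η (n + 2) - η (n + 1) = 2⁻¹ * (1 + η (n + 1) * η (n + 1)) -
              2⁻¹ * (1 + η n * η n) := by rw [← hηs, ← hηs]
          _ = _ := by ring
      have h0 := (norm_nonneg _).trans ih
      rw [e1, e2, norm_smul, h2]
      gcongr
      refine (norm_add_le _ _).trans (add_le_add ?_ ?_)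
      · exact (norm_mul_le _ _).trans
          (mul_le_mul (hyn _) ih (norm_nonneg _) (hη _).1)
      · exact (norm_mul_le _ _).trans (mul_le_mul ih (hyn _) (norm_nonneg _) h0)
  have hsum : Summable fun n => η (n + 1) - η n := by
    refine summable_of_sum_range_le (c := 1) (fun n => (norm_nonneg _).trans (hd n)) fun n => ?_
    rw [Finset.sum_range_sub, hη0, sub_zero]
    exact (hη n).2
  have hc : CauchySeq y := cauchySeq_of_dist_le_of_summable _ (fun n => by
    rw [dist_comm, dist_eq_norm]; exact hd n) hsum
  obtain ⟨z, hz⟩ := cauchySeq_tendsto_of_complete hc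
  refine ⟨z, ?_, ?_, ?_⟩
  · exact le_of_tendsto hz.norm (Eventually.of_forall fun n => (hyn n).trans (hη n).2)
  · have h1 : Tendsto (fun n => (2 : 𝕜) • y (n + 1)) atTop (𝓝 ((2 : 𝕜) • z)) :=
      (hz.comp (tendsto_add_atTop_nat 1)).const_smul _
    have h3 : Tendsto (fun n => x + y n * y n) atTop (𝓝 (x + z * z)) :=
      (hz.mul hz).const_add x
    refine tendsto_nhds_unique h1 (h3.congr fun n => ?_)
    rw [hys, smul_smul]
    simp
  · intro s hs h0 hstep
    refine hs.mem_of_tendsto hz (Eventually.of_forall fun n => ?_)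
    induction n with
    | zero => exact h0
    | succ n ih => rw [hys]; exact hstep _ ih

variable {𝕜 : Type*} [RCLike 𝕜] {H : Type*} [NormedAddCommGroup H] [InnerProductSpace 𝕜 H]
  [CompleteSpace H]

local notation "⟪" x ", " y "⟫" => inner 𝕜 x y

theorem inner_apply_left_of_isSelfAdjoint {T : H →L[𝕜] H} (hT : IsSelfAdjoint T) (x y : H) :
    ⟪T x, y⟫ = ⟪x, T y⟫ :=
  (isSelfAdjoint_iff_isSymmetric.1 hT) x y

omit [CompleteSpace H] in
theorem norm_sub_apply_sq {T : H →L[𝕜] H} (x : H) :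
    ‖x - T x‖ ^ 2 = ‖x‖ ^ 2 - 2 * re ⟪T x, x⟫ + ‖T x‖ ^ 2 := by
  rw [@norm_sub_sq 𝕜, inner_re_symm]

/-- Take `Y = 1 - y` with `2y = (1 - X²) + y²`, so that `Y² = X²`; `‖y‖ ≤ 1` makes `Y` positive.
Membership, self-adjointness and commutation are closed conditions preserved by the iteration, so
they pass to `y`. -/
theorem exists_abs_of_norm_le_one (B : StarSubalgebra 𝕜 (H →L[𝕜] H))
    (hB : IsClosed (B : Set (H →L[𝕜] H))) {X : H →L[𝕜] H} (hXB : X ∈ B) (hX : IsSelfAdjoint X)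
    (hX1 : ‖X‖ ≤ 1) :
    ∃ Y ∈ B, Y.IsPositive ∧ Y * Y = X * X ∧ ∀ Z, Commute Z X → Commute Z Y := by
  have hn : ‖1 - X * X‖ ≤ 1 := by
    refine ContinuousLinearMap.opNorm_le_bound _ zero_le_one fun x => ?_
    have h1 := norm_sub_apply_sq (𝕜 := 𝕜) (T := X * X) x
    have h2 : re ⟪(X * X) x, x⟫ = ‖X x‖ ^ 2 := by
      change re ⟪X (X x), x⟫ = _
      rw [inner_apply_left_of_isSelfAdjoint hX, inner_self_eq_norm_sq]
    have h3 : ‖(X * X) x‖ ≤ ‖X x‖ := by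
      simpa using (X.le_opNorm (X x)).trans
        (mul_le_mul_of_nonneg_right hX1 (norm_nonneg _))
    rw [one_mul]
    refine le_of_sq_le_sq ?_ (norm_nonneg _)
    change ‖x - (X * X) x‖ ^ 2 ≤ _
    rw [h1, h2]
    nlinarith [norm_nonneg ((X * X) x), norm_nonneg (X x)]
  obtain ⟨y, hy1, hy2, hys⟩ := exists_two_smul_eq_add_mul_self (𝕜 := 𝕜) (1 - X * X) hn
  have hyB : y ∈ B := hys B hB (zero_mem B) fun z hz =>
    B.smul_mem (add_mem (sub_mem (one_mem B) (mul_mem hXB hXB)) (mul_mem hz hz)) _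
  have hysa : IsSelfAdjoint y := by
    refine hys {z | IsSelfAdjoint z} (isClosed_eq continuous_star continuous_id)
      (IsSelfAdjoint.zero _) fun z hz => ?_
    have hz : star z = z := hz
    change star _ = _
    rw [star_smul, star_add, star_sub, star_mul, star_mul, hX.star_eq, hz]
    simp
  refine ⟨1 - y, sub_mem (one_mem B) hyB, ?_, ?_, ?_⟩
  · refine ⟨isSelfAdjoint_iff_isSymmetric.1 ((IsSelfAdjoint.one _).sub hysa), fun x => ?_⟩
    have h1 : re ⟪y x, x⟫ ≤ ‖x‖ * ‖x‖ := (re_inner_le_norm _ _).trans (by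
      gcongr
      simpa using (y.le_opNorm x).trans (mul_le_mul_of_nonneg_right hy1 (norm_nonneg _)))
    change 0 ≤ re ⟪x - y x, x⟫
    rw [inner_sub_left, map_sub, inner_self_eq_norm_sq]
    linarith [sq ‖x‖]
  · have : (1 - y) * (1 - y) = 1 - (2 : 𝕜) • y + y * y := by
      rw [two_smul]; noncomm_ring
    rw [this, hy2]
    abel
  · intro Z hZ
    refine (Commute.one_right Z).sub_right ?_
    refine hys {z | Z * z = z * Z}
      (isClosed_eq (continuous_const.mul continuous_id) (continuous_id.mul continuous_const))
      (by simp) fun z hz => ?_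
    have hz : Commute Z z := hz
    exact ((((Commute.one_right Z).sub_right (hZ.mul_right hZ)).add_right
      (hz.mul_right hz)).smul_right _)

/-- The absolute value of a self-adjoint operator. -/
theorem exists_abs (B : StarSubalgebra 𝕜 (H →L[𝕜] H))
    (hB : IsClosed (B : Set (H →L[𝕜] H))) {X : H →L[𝕜] H} (hXB : X ∈ B) (hX : IsSelfAdjoint X) :
    ∃ Y ∈ B, Y.IsPositive ∧ Y * Y = X * X ∧ ∀ Z, Commute Z X → Commute Z Y := by
  have h0 : (0 : ℝ) < ‖X‖ + 1 := by positivity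
  have hk : ((‖X‖ + 1 : ℝ) : 𝕜) ≠ 0 := by exact_mod_cast h0.ne'
  set k : 𝕜 := ((‖X‖ + 1 : ℝ) : 𝕜) with hkdef
  have hsa : IsSelfAdjoint (k⁻¹ • X) := by
    change star _ = _
    rw [star_smul, hX.star_eq]
    simp [hkdef]
  have hnorm : ‖k⁻¹ • X‖ ≤ 1 := by
    rw [norm_smul, norm_inv, hkdef, RCLike.norm_ofReal, abs_of_pos h0, inv_mul_le_iff₀ h0]
    linarith
  obtain ⟨Y, hYB, hYp, hYY, hYc⟩ := exists_abs_of_norm_le_one B hB (B.smul_mem hXB k⁻¹) hsa hnorm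
  refine ⟨k • Y, B.smul_mem hYB k, hYp.smul_of_nonneg ?_, ?_, fun Z hZ =>
    (hYc Z (hZ.smul_right _)).smul_right _⟩
  · rw [hkdef]; exact_mod_cast h0.le
  · rw [smul_mul_smul_comm, hYY, smul_mul_smul_comm, smul_smul]
    have : k * k * (k⁻¹ * k⁻¹) = 1 := by field_simp
    rw [this, one_smul]

/-! ### Positive and negative parts, and spectral projections. -/

/-- The range of `g` lies in `ker f`, so `g` vanishes on the orthogonal complement of `ker f`, while
on `ker f` it agrees with `f + g`. -/
theorem isPositive_right_of_mul_eq_zero {f g : H →L[𝕜] H} (hg : IsSelfAdjoint g)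
    (hfg : f * g = 0) (hp : (f + g).IsPositive) : g.IsPositive := by
  refine ⟨isSelfAdjoint_iff_isSymmetric.1 hg, fun x => ?_⟩
  let K : Submodule 𝕜 H := LinearMap.ker (f : H →ₗ[𝕜] H)
  have hKc : IsClosed (K : Set H) := f.isClosed_ker
  have : CompleteSpace K := hKc.completeSpace_coe
  have hgK : ∀ y, g y ∈ K := fun y => by
    change (f * g) y = 0
    rw [hfg]; rfl
  obtain ⟨y, hy, z, hz, rfl⟩ := K.exists_add_mem_mem_orthogonal x
  have hgz : g z = 0 := by
    have : ⟪g z, g z⟫ = 0 := by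
      rw [inner_apply_left_of_isSelfAdjoint hg]
      exact Submodule.inner_left_of_mem_orthogonal (hgK _) hz
    exact inner_self_eq_zero.1 this
  have h1 : f y = 0 := hy
  have h2 := hp.re_inner_nonneg_left y
  rw [add_apply, h1, zero_add] at h2
  change 0 ≤ re ⟪g (y + z), y + z⟫
  rw [map_add, hgz, add_zero, inner_add_right,
    Submodule.inner_right_of_mem_orthogonal (hgK y) hz, add_zero]
  exact h2

/-- The positive and the negative part of a self-adjoint operator. -/
theorem exists_posPart_negPart (B : StarSubalgebra 𝕜 (H →L[𝕜] H))
    (hB : IsClosed (B : Set (H →L[𝕜] H))) {X : H →L[𝕜] H} (hXB : X ∈ B) (hX : IsSelfAdjoint X) :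
    ∃ f ∈ B, ∃ g ∈ B, f.IsPositive ∧ g.IsPositive ∧ f - g = X ∧ f * g = 0 ∧ g * f = 0 ∧
      (∀ Z, Commute Z X → Commute Z f) ∧ ∀ Z, Commute Z X → Commute Z g := by
  obtain ⟨Y, hYB, hYp, hYY, hYc⟩ := exists_abs B hB hXB hX
  have hXY : X * Y = Y * X := (hYc X (Commute.refl X))
  have hfg : ((2⁻¹ : 𝕜) • (Y + X)) * ((2⁻¹ : 𝕜) • (Y - X)) = 0 := by
    have : (Y + X) * (Y - X) = 0 := by
      rw [add_mul, mul_sub, mul_sub, hYY, hXY]; abel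
    rw [smul_mul_smul_comm, this, smul_zero]
  have hgf : ((2⁻¹ : 𝕜) • (Y - X)) * ((2⁻¹ : 𝕜) • (Y + X)) = 0 := by
    have : (Y - X) * (Y + X) = 0 := by
      rw [sub_mul, mul_add, mul_add, hYY, hXY]; abel
    rw [smul_mul_smul_comm, this, smul_zero]
  have hsum : (2⁻¹ : 𝕜) • (Y + X) + (2⁻¹ : 𝕜) • (Y - X) = Y := by
    rw [← smul_add]
    have : Y + X + (Y - X) = (2 : 𝕜) • Y := by rw [two_smul]; abel
    rw [this, smul_smul]; simp
  have h2 : IsSelfAdjoint (2⁻¹ : 𝕜) := by change star _ = _; simp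
  refine ⟨(2⁻¹ : 𝕜) • (Y + X), B.smul_mem (add_mem hYB hXB) _,
    (2⁻¹ : 𝕜) • (Y - X), B.smul_mem (sub_mem hYB hXB) _, ?_, ?_, ?_, hfg, hgf, ?_, ?_⟩
  · exact isPositive_right_of_mul_eq_zero (h2.smul (hYp.isSelfAdjoint.add hX)) hgf
      (by rw [add_comm, hsum]; exact hYp)
  · exact isPositive_right_of_mul_eq_zero (h2.smul (hYp.isSelfAdjoint.sub hX)) hfg
      (by rw [hsum]; exact hYp)
  · rw [← smul_sub]
    have : Y + X - (Y - X) = (2 : 𝕜) • X := by rw [two_smul]; abel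
    rw [this, smul_smul]; simp
  · exact fun Z hZ => ((hYc Z hZ).add_right hZ).smul_right _
  · exact fun Z hZ => ((hYc Z hZ).sub_right hZ).smul_right _

/-- The spectral projection of `(0, ∞)` for an invertible self-adjoint operator. -/
theorem exists_spectralProjection (B : StarSubalgebra 𝕜 (H →L[𝕜] H))
    (hB : IsClosed (B : Set (H →L[𝕜] H))) {S S' : H →L[𝕜] H} (hSB : S ∈ B) (hS : IsSelfAdjoint S)
    (hS'B : S' ∈ B) (h1 : S * S' = 1) (h2 : S' * S = 1) :
    ∃ p ∈ B, IsStarProjection p ∧ ∃ Y : H →L[𝕜] H, Y.IsPositive ∧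
      p * S = Y * p ∧ (1 - p) * S = -(Y * (1 - p)) := by
  obtain ⟨f, hfB, g, hgB, hf, hg, hfgS, hfg, hgf, hfc, hgc⟩ := exists_posPart_negPart B hB hSB hS
  have hS'S : Commute S' S := h2.trans h1.symm
  have cf : S' * f = f * S' := hfc _ hS'S
  have hS' : star S' = S' := by
    have : star S' * S = 1 := by
      rw [← hS.star_eq, ← star_mul, h1, star_one]
    calc star S' = star S' * (S * S') := by rw [h1, mul_one]
      _ = S' := by rw [← mul_assoc, this, one_mul]
  have hfS : f * S = f * f := by rw [← hfgS, mul_sub, hfg, sub_zero]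
  have hgS : g * S = -(g * g) := by rw [← hfgS, mul_sub, hgf, zero_sub]
  have hff : f * f * S' = f := by rw [← hfS, mul_assoc, h1, mul_one]
  have hgg : g * g * S' = -g := by rw [← neg_eq_iff_eq_neg, ← neg_mul, ← hgS, mul_assoc, h1, mul_one]
  have hp : 1 - f * S' = -(g * S') := by
    rw [← h1, ← hfgS, sub_mul]; abel
  -- With `S = f - g`, the operator `f S⁻¹` is the identity on the positive part and `0` on the
  -- negative one; `f + g` is `|S|`.
  refine ⟨f * S', mul_mem hfB hS'B, ⟨?_, ?_⟩, f + g, hf.add hg, ?_, ?_⟩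
  · change f * S' * (f * S') = f * S'
    rw [mul_assoc, ← mul_assoc S' f, cf, ← mul_assoc, ← mul_assoc, hff]
  · change star _ = _
    rw [star_mul, hS', hf.isSelfAdjoint.star_eq, cf]
  · rw [mul_assoc, h2, mul_one, add_mul, ← mul_assoc, ← mul_assoc, hgf, zero_mul, add_zero, hff]
  · rw [hp, neg_mul, mul_assoc, h2, mul_one, mul_neg, neg_neg, add_mul, ← mul_assoc, ← mul_assoc,
      hfg, zero_mul, zero_add, hgg]

theorem IsSelfAdjoint.of_mul_eq_one {R : Type*} [Ring R] [StarRing R] {N M : R}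
    (hN : IsSelfAdjoint N) (h1 : N * M = 1) : IsSelfAdjoint M := by
  have h2 : star M * N = 1 := by rw [← hN.star_eq, ← star_mul, h1, star_one]
  calc star M = star M * (N * M) := by rw [h1, mul_one]
    _ = M := by rw [← mul_assoc, h2, one_mul]

/-- The projection onto the kernel of a small perturbation of a projection. -/
theorem exists_kernelProjection (B : StarSubalgebra 𝕜 (H →L[𝕜] H))
    (hB : IsClosed (B : Set (H →L[𝕜] H))) {r v : H →L[𝕜] H} (hrB : r ∈ B)
    (hr : IsStarProjection r) (hvB : v ∈ B) (hrv : r * v = v) (hv : ‖v - r‖ ≤ 1 / 4) :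
    ∃ q ∈ B, IsStarProjection q ∧ ∀ x, q x = x ↔ v x = 0 := by
  have hrs : star r = r := hr.isSelfAdjoint.star_eq
  have hrr : r * r = r := hr.isIdempotentElem
  have hvr : star v * r = star v := by
    conv_rhs => rw [← hrv, star_mul, hrs]
  obtain ⟨k, hk⟩ : ∃ k, k = v - r := ⟨_, rfl⟩
  have hkn : ‖k‖ ≤ 1 / 4 := hk ▸ hv
  have hksn : ‖star k‖ ≤ 1 / 4 := (norm_star k).trans_le hkn
  have hvk : v = r + k := by rw [hk]; abel
  have hr1 : ‖r‖ ≤ 1 := hr.norm_le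
  -- `1 - t` is `v v* + (1 - r)`: `v` maps into the range of `r`, and adding `1 - r` makes `v v*`
  -- invertible on all of `H`, as `‖t‖ ≤ 1/4 + 1/4 + 1/16 < 1`.
  obtain ⟨t, ht⟩ : ∃ t, t = -(r * star k + k * r + k * star k) := ⟨_, rfl⟩
  have htN : 1 - t = v * star v + (1 - r) := by
    rw [ht, hvk, star_add, hrs, add_mul, mul_add, mul_add, hrr]; abel
  have htn : ‖t‖ < 1 := by
    have h1 : ‖r * star k‖ ≤ 1 * (1 / 4) := (norm_mul_le _ _).trans (by gcongr)
    have h2 : ‖k * r‖ ≤ (1 / 4) * 1 := (norm_mul_le _ _).trans (by gcongr)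
    have h3 : ‖k * star k‖ ≤ (1 / 4) * (1 / 4) := (norm_mul_le _ _).trans (by gcongr)
    rw [ht, norm_neg]
    have h4 := norm_add_le (r * star k + k * r) (k * star k)
    have h5 := norm_add_le (r * star k) (k * r)
    linarith
  have hvsB : star v ∈ B := star_mem hvB
  have htB : t ∈ B := by
    have : t = 1 - (v * star v + (1 - r)) := by rw [← htN]; abel
    rw [this]
    exact sub_mem (one_mem B) (add_mem (mul_mem hvB hvsB) (sub_mem (one_mem B) hrB))
  obtain ⟨M, hM⟩ : ∃ M, M = ∑' n : ℕ, t ^ n := ⟨_, rfl⟩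
  have hMB : M ∈ B := hM ▸ tsum_mem (s := B) hB fun n => pow_mem htB n
  obtain ⟨N, hN⟩ : ∃ N, N = v * star v + (1 - r) := ⟨_, rfl⟩
  have hNM : N * M = 1 := by rw [hN, ← htN, hM]; exact mul_neg_geom_series t htn
  have hMN : M * N = 1 := by rw [hN, ← htN, hM]; exact geom_series_mul_neg t htn
  have hNs : IsSelfAdjoint N := by
    change star N = N
    rw [hN, star_add, star_mul, star_star, star_sub, star_one, hrs]
  have hMs : star M = M := (IsSelfAdjoint.of_mul_eq_one hNs hNM).star_eq
  have hNr : N * r = r * N := by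
    rw [hN, add_mul, mul_add, mul_assoc, hvr, ← mul_assoc, hrv, sub_mul, mul_sub, one_mul, mul_one]
  have hMr : M * r = r * M := by
    calc M * r = M * r * (N * M) := by rw [hNM, mul_one]
      _ = M * (N * r) * M := by rw [hNr]; simp only [mul_assoc]
      _ = r * M := by rw [← mul_assoc, hMN, one_mul]
  have hvv : v * star v = N - (1 - r) := by rw [hN]; abel
  have hrMv : (1 - r) * (M * v) = 0 := by
    rw [sub_mul, one_mul, ← mul_assoc, ← hMr, mul_assoc, hrv, sub_self]
  have hvπ : v * (star v * M * v) = v := by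
    calc v * (star v * M * v) = (v * star v) * (M * v) := by simp only [mul_assoc]
      _ = v := by rw [hvv, sub_mul, hrMv, sub_zero, ← mul_assoc, hNM, one_mul]
  -- With `M = (v v* + 1 - r)⁻¹`, `v* M v` is the support projection of `v`; its complement projects
  -- onto `ker v`.
  have hπ : IsStarProjection (star v * M * v) := by
    refine ⟨?_, ?_⟩
    · change _ * _ = _
      rw [mul_assoc, hvπ]
    · change star _ = _
      rw [star_mul, star_mul, star_star, hMs, mul_assoc]
  refine ⟨1 - star v * M * v, sub_mem (one_mem B) (mul_mem (mul_mem hvsB hMB) hvB),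
    hπ.one_sub, fun x => ⟨fun h => ?_, fun h => ?_⟩⟩
  · have h1 : (star v * M * v) x = 0 := by
      have : x - (star v * M * v) x = x := h
      simpa using this
    rw [← hvπ]
    change v ((star v * M * v) x) = 0
    rw [h1, map_zero]
  · change x - (star v * M) (v x) = x
    rw [h, map_zero, sub_zero]

/-! ### Interpolation by projections. -/

-- `1 + Y` is bounded below by `1`: pair `w x` with `z x` and apply Cauchy–Schwarz.
omit [CompleteSpace H] in
theorem norm_le_of_add_positive_mul {Y z w : H →L[𝕜] H} (hY : Y.IsPositive)
    (h : z + Y * z = w) : ‖z‖ ≤ ‖w‖ := by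
  refine ContinuousLinearMap.opNorm_le_bound _ (norm_nonneg _) fun x => ?_
  have h1 : re ⟪w x, z x⟫ = ‖z x‖ ^ 2 + re ⟪Y (z x), z x⟫ := by
    rw [← h]
    change re ⟪z x + Y (z x), z x⟫ = _
    rw [inner_add_left, map_add, inner_self_eq_norm_sq]
  have h2 := hY.re_inner_nonneg_left (z x)
  have h3 : re ⟪w x, z x⟫ ≤ ‖w x‖ * ‖z x‖ := re_inner_le_norm _ _
  have h4 := w.le_opNorm x
  by_cases h0 : ‖z x‖ = 0
  · rw [h0]; positivity
  · have : 0 < ‖z x‖ := lt_of_le_of_ne (norm_nonneg _) (Ne.symm h0)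
    refine le_trans ?_ h4
    refine le_of_mul_le_mul_right ?_ this
    nlinarith

/-- Invertible self-adjoint elements of a unital algebra approximate all self-adjoint elements. -/
def InvertiblesApproximate (B : StarSubalgebra 𝕜 (H →L[𝕜] H)) : Prop :=
  ∀ h ∈ B, IsSelfAdjoint h → ∀ ε > 0, ∃ S ∈ B, IsSelfAdjoint S ∧
    (∃ S' ∈ B, S * S' = 1 ∧ S' * S = 1) ∧ ‖S - h‖ < ε

/-- Replace `h` by an invertible `S` within `ε` and let `p` be its positive spectral projection.
Since `(1 - p) S = -Y (1 - p)` and `h c = c`, `(1 + Y)(1 - p) c = -(1 - p)(S - h) c`, which is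
small; similarly for `p d`. -/
theorem exists_approximate_interpolation {B : StarSubalgebra 𝕜 (H →L[𝕜] H)}
    (hB : IsClosed (B : Set (H →L[𝕜] H))) (hd : InvertiblesApproximate B) {h c d : H →L[𝕜] H}
    (hhB : h ∈ B) (hh : IsSelfAdjoint h) (hhc : h * c = c) (hhd : h * d = -d) {ε : ℝ}
    (hε : 0 < ε) :
    ∃ p ∈ B, IsStarProjection p ∧ ‖(1 - p) * c‖ ≤ ε * ‖c‖ ∧ ‖p * d‖ ≤ ε * ‖d‖ := by
  obtain ⟨S, hSB, hS, ⟨S', hS'B, h1, h2⟩, hSh⟩ := hd h hhB hh ε hε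
  obtain ⟨p, hpB, hp, Y, hY, hpS, hrS⟩ := exists_spectralProjection B hB hSB hS hS'B h1 h2
  refine ⟨p, hpB, hp, ?_, ?_⟩
  · have e : (1 - p) * c + Y * ((1 - p) * c) = -((1 - p) * ((S - h) * c)) := by
      rw [sub_mul S h, hhc, mul_sub, ← mul_assoc (1 - p) S, hrS, neg_mul, ← mul_assoc Y]
      abel
    refine (norm_le_of_add_positive_mul hY e).trans ?_
    rw [norm_neg]
    calc ‖(1 - p) * ((S - h) * c)‖ ≤ ‖1 - p‖ * (‖S - h‖ * ‖c‖) :=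
          (norm_mul_le _ _).trans (by gcongr; exact norm_mul_le _ _)
      _ ≤ 1 * (ε * ‖c‖) := by gcongr; exact hp.one_sub.norm_le
      _ = _ := one_mul _
  · have e : p * d + Y * (p * d) = p * ((S - h) * d) := by
      rw [sub_mul S h, hhd, sub_neg_eq_add, mul_add, ← mul_assoc p S, hpS, ← mul_assoc Y]
      abel
    refine (norm_le_of_add_positive_mul hY e).trans ?_
    calc ‖p * ((S - h) * d)‖ ≤ ‖p‖ * (‖S - h‖ * ‖d‖) :=
          (norm_mul_le _ _).trans (by gcongr; exact norm_mul_le _ _)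
      _ ≤ 1 * (ε * ‖d‖) := by gcongr; exact hp.norm_le
      _ = _ := one_mul _

/-- Interpolation by projections: if `h` is `1` on the range of `c` and `-1` on the range of `d`,
there is a projection above the fixed vectors of `c` and orthogonal to those of `d`. -/
theorem exists_interpolation {B : StarSubalgebra 𝕜 (H →L[𝕜] H)}
    (hB : IsClosed (B : Set (H →L[𝕜] H))) (hd : InvertiblesApproximate B) {h c d : H →L[𝕜] H}
    (hhB : h ∈ B) (hh : IsSelfAdjoint h) (hcB : c ∈ B) (hdB : d ∈ B)
    (hdsa : IsSelfAdjoint d) (hhc : h * c = c) (hhd : h * d = -d) (hdc : d * c = 0) :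
    ∃ q ∈ B, IsStarProjection q ∧ (∀ x, c x = x → q x = x) ∧ ∀ x, d x = x → q x = 0 := by
  obtain ⟨K, hK⟩ : ∃ K, K = ‖c‖ + ‖d‖ + 1 := ⟨_, rfl⟩
  have hc0 := norm_nonneg c
  have hd0 := norm_nonneg d
  have hK1 : 1 ≤ K := by linarith
  have hcK : ‖c‖ ≤ K := by linarith
  have hdK : ‖d‖ ≤ K := by linarith
  -- Chosen so that `ε K` and `K (ε K)` are each at most `1/8`; together they meet the bound `1/4`
  -- of `exists_kernelProjection`.
  obtain ⟨ε, hε⟩ : ∃ ε, ε = 1 / (8 * K ^ 2) := ⟨_, rfl⟩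
  have hε0 : 0 < ε := by rw [hε]; positivity
  have hεK : ε * K * K = 1 / 8 := by rw [hε]; field_simp
  have hεK1 : ε * K ≤ 1 / 8 := by
    rw [← hεK]; exact le_mul_of_one_le_right (by positivity) hK1
  obtain ⟨p, hpB, hp, hpc, hpd⟩ := exists_approximate_interpolation hB hd hhB hh hhc hhd hε0
  obtain ⟨r, hr⟩ : ∃ r, r = 1 - p := ⟨_, rfl⟩
  have hrp : IsStarProjection r := hr ▸ hp.one_sub
  have hrB : r ∈ B := hr ▸ sub_mem (one_mem B) hpB
  rw [← hr] at hpc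
  have hrc : ‖r * c‖ ≤ ε * K := hpc.trans (by gcongr)
  have hpd' : ‖p * d‖ ≤ ε * K := hpd.trans (by gcongr)
  have hrr : r * r = r := hrp.isIdempotentElem
  -- First correction of `p`: `q` contains the fixed vectors of `c` exactly and is still almost
  -- orthogonal to `d`.
  obtain ⟨q, hqB, hq, hqx⟩ := exists_kernelProjection B hB (r := r) (v := r * (1 - c)) hrB hrp
    (mul_mem hrB (sub_mem (one_mem B) hcB)) (by rw [← mul_assoc, hrr])
    (by rw [mul_sub, mul_one, sub_sub_cancel_left, norm_neg]; linarith)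
  have hqq : q * q = q := hq.isIdempotentElem
  have hqs := hq.isSelfAdjoint.star_eq
  have hrq : r * q = r * c * q := by
    ext x
    have h1 : (r * (1 - c)) (q x) = 0 := (hqx (q x)).1 (by
      change (q * q) x = _
      rw [hqq])
    have h2 : r (q x) - (r * c) (q x) = 0 := by
      rw [← h1, mul_sub, mul_one]; rfl
    exact sub_eq_zero.1 h2
  have hdq : d * q = d * p * q + d * (r * c) * q := by
    rw [mul_assoc d (r * c), ← hrq, hr]
    noncomm_ring
  have hdp : ‖d * p‖ ≤ ε * K := by
    rw [← norm_star, star_mul, hdsa.star_eq, hp.isSelfAdjoint.star_eq]; exact hpd'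
  have hqd : ‖q * d‖ ≤ 1 / 4 := by
    rw [← norm_star, star_mul, hdsa.star_eq, hqs, hdq]
    have h1 : ‖d * p * q‖ ≤ ε * K * 1 :=
      (norm_mul_le _ _).trans (by gcongr; exact hq.norm_le)
    have h2 : ‖d * (r * c) * q‖ ≤ K * (ε * K) * 1 :=
      (norm_mul_le _ _).trans (by
        gcongr
        · exact (norm_mul_le _ _).trans (by gcongr)
        · exact hq.norm_le)
    refine (norm_add_le _ _).trans ?_
    linarith [mul_comm K (ε * K)]
  -- Second correction: `s` contains the fixed vectors of `d`, so `1 - s` annihilates them. Fixed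
  -- vectors of `c` are orthogonal to the range of `s`, because `d c = 0`.
  obtain ⟨s, hsB, hs, hsx⟩ := exists_kernelProjection B hB (r := q) (v := q * (1 - d)) hqB hq
    (mul_mem hqB (sub_mem (one_mem B) hdB)) (by rw [← mul_assoc, hqq])
    (by rw [mul_sub, mul_one, sub_sub_cancel_left, norm_neg]; exact hqd)
  have hss : s * s = s := hs.isIdempotentElem
  refine ⟨1 - s, sub_mem (one_mem B) hsB, hs.one_sub, fun x hx => ?_, fun x hx => ?_⟩
  · have hqx' : q x = x := (hqx x).2 (by
      change r (x - c x) = 0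
      rw [hx, sub_self, map_zero])
    have hdx : d x = 0 := by
      rw [← hx]
      change (d * c) x = 0
      rw [hdc]; rfl
    have h1 : q (s x - d (s x)) = 0 := (hsx (s x)).1 (by
      change (s * s) x = _
      rw [hss])
    have h2 : ⟪x, s x⟫ = 0 := by
      calc ⟪x, s x⟫ = ⟪q x, s x - d (s x)⟫ + ⟪d x, s x⟫ := by
            rw [hqx', inner_sub_right, inner_apply_left_of_isSelfAdjoint hdsa]; ring
        _ = 0 := by
          rw [inner_apply_left_of_isSelfAdjoint hq.isSelfAdjoint, h1, hdx]; simp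
    have h3 : ⟪s x, s x⟫ = 0 := by
      rw [inner_apply_left_of_isSelfAdjoint hs.isSelfAdjoint]
      change ⟪x, (s * s) x⟫ = 0
      rw [hss, h2]
    change x - s x = x
    rw [inner_self_eq_zero.1 h3, sub_zero]
  · have : s x = x := (hsx x).2 (by
      change q (x - d x) = 0
      rw [hx, sub_self, map_zero])
    change x - s x = 0
    rw [this, sub_self]

/-! ### Cutoff functions of a self-adjoint operator. -/

theorem isSelfAdjoint_ofReal_smul {T : H →L[𝕜] H} (hT : IsSelfAdjoint T) (t : ℝ) :
    IsSelfAdjoint ((t : 𝕜) • T) :=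
  IsSelfAdjoint.smul (show star (t : 𝕜) = t by simp) hT

/-- The positive and negative parts of `D - t`, for all real `t`. -/
theorem exists_posPart_negPart_family (B : StarSubalgebra 𝕜 (H →L[𝕜] H))
    (hB : IsClosed (B : Set (H →L[𝕜] H))) {D : H →L[𝕜] H} (hDB : D ∈ B) (hD : IsSelfAdjoint D) :
    ∃ f g : ℝ → (H →L[𝕜] H), (∀ t, f t ∈ B) ∧ (∀ t, (f t).IsPositive) ∧
      (∀ t, (g t).IsPositive) ∧ (∀ t, f t - g t = D - (t : 𝕜) • 1) ∧
      (∀ t, f t * g t = 0) ∧ (∀ t, g t * f t = 0) ∧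
      (∀ s t, Commute (g s) (f t)) := by
  have key : ∀ t : ℝ, ∃ f ∈ B, ∃ g ∈ B, f.IsPositive ∧ g.IsPositive ∧ f - g = D - (t : 𝕜) • 1 ∧
      f * g = 0 ∧ g * f = 0 ∧ (∀ Z, Commute Z (D - (t : 𝕜) • 1) → Commute Z f) ∧
      ∀ Z, Commute Z (D - (t : 𝕜) • 1) → Commute Z g := fun t =>
    exists_posPart_negPart B hB (sub_mem hDB (B.smul_mem (one_mem B) _))
      (hD.sub (isSelfAdjoint_ofReal_smul (IsSelfAdjoint.one _) t))
  choose f hf g hg hfp hgp hfg h0 h0' hcf hcg using key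
  have hDc : ∀ s t : ℝ, Commute (D - (s : 𝕜) • 1) (D - (t : 𝕜) • 1) := fun s t =>
    (((Commute.refl D).sub_right ((Commute.one_right D).smul_right _))).sub_left
      (((Commute.one_left _).smul_left _))
  refine ⟨f, g, hf, hfp, hgp, hfg, h0, h0', fun s t => ?_⟩
  · exact (hcg s _ (hcf t _ (hDc s t)).symm).symm

-- The parts `(D - t)₊` and `(D - s)₋` have disjoint supports. Algebraically, `((t - s) + g s + f t)
-- (f t * g s) = 0`, and for `s < t` the first factor is bounded below.
omit [CompleteSpace H] in
theorem posPart_mul_negPart_eq_zero {D : H →L[𝕜] H} {f g : ℝ → (H →L[𝕜] H)}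
    (hfp : ∀ t, (f t).IsPositive) (hgp : ∀ t, (g t).IsPositive)
    (hfg : ∀ t, f t - g t = D - (t : 𝕜) • 1) (h0 : ∀ t, f t * g t = 0)
    (hgf : ∀ s t, Commute (g s) (f t)) {s t : ℝ} (hst : s ≤ t) :
    f t * g s = 0 := by
  rcases hst.eq_or_lt with rfl | hst
  · exact h0 _
  have hpos : 0 < t - s := sub_pos.2 hst
  have hk : (((t - s : ℝ)) : 𝕜) ≠ 0 := by exact_mod_cast hpos.ne'
  have hfs : f t * (f t) - f t * f s + f t * g s = -(((t - s : ℝ) : 𝕜) • f t) := by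
    have : f t - g t - (f s - g s) = -(((t - s : ℝ) : 𝕜) • (1 : H →L[𝕜] H)) := by
      rw [hfg, hfg, RCLike.ofReal_sub, sub_smul]; abel
    have h2 := congrArg (fun z => f t * z) this
    simp only [mul_sub, h0 t, sub_zero, mul_neg, mul_smul_comm, mul_one] at h2
    rw [← h2]; abel
  have h3 : ((t - s : ℝ) : 𝕜) • (f t * g s) + (g s + f t) * (f t * g s) = 0 := by
    have h4 := congrArg (fun z => z * g s) hfs
    simp only [add_mul, sub_mul, neg_mul, smul_mul_assoc, mul_assoc, h0 s, mul_zero,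
      sub_zero] at h4
    have h5 : g s * (f t * g s) = f t * (g s * g s) := by
      rw [← mul_assoc, (hgf s t).eq, mul_assoc]
    rw [add_mul, h5, ← neg_eq_iff_eq_neg.2 h4]
    abel
  have hY : ((((t - s : ℝ)) : 𝕜)⁻¹ • (g s + f t)).IsPositive := by
    refine ((hgp s).add (hfp t)).smul_of_nonneg ?_
    rw [← RCLike.ofReal_inv]
    exact_mod_cast (inv_pos.2 hpos).le
  have h6 : f t * g s + ((((t - s : ℝ)) : 𝕜)⁻¹ • (g s + f t)) * (f t * g s) = 0 := by
    have := congrArg (fun z => (((t - s : ℝ)) : 𝕜)⁻¹ • z) h3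
    rwa [smul_add, smul_smul, inv_mul_cancel₀ hk, one_smul, smul_zero, ← smul_mul_assoc] at this
  exact norm_le_zero_iff.1 ((norm_le_of_add_positive_mul hY h6).trans norm_zero.le)

/-- Piecewise linear cutoff functions `u k` of a positive operator `D`, with `u k` equal to `1` for
`D ≤ t (k + 1)` and to `0` for `t k ≤ D`. -/
theorem exists_cutoffs (B : StarSubalgebra 𝕜 (H →L[𝕜] H))
    (hB : IsClosed (B : Set (H →L[𝕜] H))) {D : H →L[𝕜] H} (hDB : D ∈ B) (hD : IsSelfAdjoint D)
    (t : ℕ → ℝ) (ht : StrictAnti t) (ht0 : ∀ n, 0 < t n) :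
    ∃ u : ℕ → (H →L[𝕜] H), (∀ k, u k ∈ B) ∧ (∀ k, IsSelfAdjoint (u k)) ∧
      (∀ k, u k * u (k + 1) = u (k + 1)) ∧ (∀ k x, D x = 0 → u k x = x) ∧
      (∀ k x, u k x = x → re ⟪D x, x⟫ ≤ t k * ‖x‖ ^ 2) ∧
      ∀ k x, u k x = 0 → t (k + 1) * ‖x‖ ^ 2 ≤ re ⟪D x, x⟫ := by
  obtain ⟨f, g, hfB, hfp, hgp, hfg, h0, h0', hgf⟩ := exists_posPart_negPart_family B hB hDB hD
  have hz : ∀ s r : ℝ, s ≤ r → f r * g s = 0 := fun s r h =>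
    posPart_mul_negPart_eq_zero hfp hgp hfg h0 hgf h
  have hinner : ∀ s : ℝ, ∀ x,
      re ⟪D x, x⟫ = re ⟪f s x, x⟫ - re ⟪g s x, x⟫ + s * ‖x‖ ^ 2 := by
    intro s x
    have h1 : D x = f s x - g s x + (s : 𝕜) • x := by
      have := congrArg (fun z : H →L[𝕜] H => z x) (hfg s)
      have h2 : f s x - g s x = D x - (s : 𝕜) • x := this
      rw [h2, sub_add_cancel]
    rw [h1, inner_add_left, inner_sub_left, map_add, map_sub, inner_smul_left, conj_ofReal,
      re_ofReal_mul, inner_self_eq_norm_sq]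
  obtain ⟨κ, hκ⟩ : ∃ κ : ℕ → 𝕜, ∀ k, κ k = ((t k - t (k + 1) : ℝ) : 𝕜) := ⟨_, fun _ => rfl⟩
  have hκ0 : ∀ k, κ k ≠ 0 := fun k => by
    rw [hκ]
    exact_mod_cast (sub_pos.2 (ht (Nat.lt_succ_self k))).ne'
  have hF : ∀ k, ∀ r, t k ≤ r → f r * (f (t (k + 1)) - f (t k)) = κ k • f r := by
    intro k r hr
    have e : f (t (k + 1)) - f (t k) = κ k • (1 : H →L[𝕜] H) + g (t (k + 1)) - g (t k) := by
      rw [hκ, RCLike.ofReal_sub, sub_smul]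
      have e1 := hfg (t (k + 1))
      have e2 := hfg (t k)
      rw [sub_eq_iff_eq_add] at e1 e2
      rw [e1, e2]; abel
    rw [e, mul_sub, mul_add, hz _ _ hr, hz _ _ ((ht (Nat.lt_succ_self k)).le.trans hr),
      mul_smul_comm, mul_one, add_zero, sub_zero]
  -- `f (t (k + 1)) - f (t k)` is the ramp rising from `0` at `t (k + 1)` to the constant `κ k` from
  -- `t k` on.
  obtain ⟨u, hu⟩ : ∃ u : ℕ → (H →L[𝕜] H),
    ∀ k, u k = 1 - (κ k)⁻¹ • (f (t (k + 1)) - f (t k)) := ⟨_, fun _ => rfl⟩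
  have hfu : ∀ k, ∀ r, t k ≤ r → f r * u k = 0 := by
    intro k r hr
    rw [hu, mul_sub, mul_one, mul_smul_comm, hF k r hr, smul_smul, inv_mul_cancel₀ (hκ0 k),
      one_smul, sub_self]
  refine ⟨u, fun k => ?_, fun k => ?_, fun k => ?_, fun k x hx => ?_, fun k x hx => ?_,
    fun k x hx => ?_⟩
  · rw [hu]
    exact sub_mem (one_mem B) (B.smul_mem (sub_mem (hfB _) (hfB _)) _)
  · rw [hu, hκ, ← RCLike.ofReal_inv]
    exact (IsSelfAdjoint.one _).sub (isSelfAdjoint_ofReal_smul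
      ((hfp _).isSelfAdjoint.sub (hfp _).isSelfAdjoint) _)
  · nth_rewrite 1 [hu k]
    rw [sub_mul, one_mul, smul_mul_assoc, sub_mul, hfu (k + 1) _ le_rfl,
      hfu (k + 1) _ (ht (Nat.lt_succ_self k)).le, sub_zero, smul_zero, sub_zero]
  -- On `ker D`, `f s x` would be an eigenvector of the positive operator `f s` for the eigenvalue
  -- `-s < 0`.
  · have hf0 : ∀ s : ℝ, 0 < s → f s x = 0 := by
      intro s hs
      have h1 : f s * f s = f s * D - (s : 𝕜) • f s := by
        have h2 := congrArg (fun z => f s * z) (hfg s)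
        simpa only [mul_sub, h0 s, sub_zero, mul_smul_comm, mul_one] using h2
      have h2 : f s (f s x) = -((s : 𝕜) • f s x) := by
        have h3 : f s (f s x) = f s (D x) - (s : 𝕜) • f s x :=
          congrArg (fun z : H →L[𝕜] H => z x) h1
        rw [h3, hx, map_zero, zero_sub]
      have h3 := (hfp s).re_inner_nonneg_left (f s x)
      rw [h2, inner_neg_left, map_neg, inner_smul_left, conj_ofReal, re_ofReal_mul,
        inner_self_eq_norm_sq] at h3
      have h4 : ‖f s x‖ ^ 2 = 0 := by nlinarith [sq_nonneg ‖f s x‖]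
      exact norm_eq_zero.1 (pow_eq_zero_iff two_ne_zero |>.1 h4)
    rw [hu]
    change x - (κ k)⁻¹ • (f (t (k + 1)) x - f (t k) x) = x
    rw [hf0 _ (ht0 _), hf0 _ (ht0 _), sub_zero, smul_zero, sub_zero]
  · have h1 : f (t k) x = 0 := by
      rw [← hx]
      change (f (t k) * u k) x = 0
      rw [hfu k _ le_rfl]; rfl
    have h2 := (hgp (t k)).re_inner_nonneg_left x
    rw [hinner (t k) x, h1, inner_zero_left, map_zero]
    linarith
  · have h1 : g (t (k + 1)) * u k = g (t (k + 1)) := by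
      rw [hu, mul_sub, mul_one, mul_smul_comm, mul_sub, h0', (hgf _ _).eq,
        hz _ _ (ht (Nat.lt_succ_self k)).le, sub_zero, smul_zero, sub_zero]
    have h2 : g (t (k + 1)) x = 0 := by
      rw [← h1]
      change g (t (k + 1)) (u k x) = 0
      rw [hx, map_zero]
    have h3 := (hfp (t (k + 1))).re_inner_nonneg_left x
    rw [hinner (t (k + 1)) x, h2, inner_zero_left, map_zero]
    linarith

/-! ### Decreasing projections towards the eigenprojection at `1`. -/

omit [CompleteSpace H] in
theorem re_inner_one_sub_apply (T : H →L[𝕜] H) (x : H) :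
    re ⟪(1 - T) x, x⟫ = ‖x‖ ^ 2 - re ⟪T x, x⟫ := by
  change re ⟪x - T x, x⟫ = _
  rw [inner_sub_left, map_sub, inner_self_eq_norm_sq]

omit [CompleteSpace H] in
theorem norm_one_sub_apply_sq_le {T : H →L[𝕜] H} (hT : ‖T‖ ≤ 1) (x : H) :
    ‖(1 - T) x‖ ^ 2 ≤ 2 * re ⟪(1 - T) x, x⟫ := by
  have h1 : ‖(1 - T) x‖ ^ 2 = _ := norm_sub_apply_sq (𝕜 := 𝕜) (T := T) x
  have h2 : ‖T x‖ ≤ ‖x‖ := by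
    simpa using (T.le_opNorm x).trans (mul_le_mul_of_nonneg_right hT (norm_nonneg _))
  rw [h1, re_inner_one_sub_apply]
  nlinarith [norm_nonneg (T x), norm_nonneg x]

/-- A decreasing sequence of projections in `A` that converges to the spectral projection of
the contraction `T` in `A` for the eigenvalue `1`. -/
theorem exists_antitone_projections (A : NonUnitalStarSubalgebra 𝕜 (H →L[𝕜] H))
    {B : StarSubalgebra 𝕜 (H →L[𝕜] H)} (hB : IsClosed (B : Set (H →L[𝕜] H)))
    (hd : InvertiblesApproximate B) (hAB : ∀ a ∈ A, a ∈ B)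
    (hl : ∀ b ∈ B, ∀ a ∈ A, b * a ∈ A) {T : H →L[𝕜] H}
    (hTA : T ∈ A) (hT : IsSelfAdjoint T) (hT1 : ‖T‖ ≤ 1) :
    ∃ Q : ℕ → (H →L[𝕜] H), (∀ n, Q n ∈ A) ∧ (∀ n, IsStarProjection (Q n)) ∧
      (∀ n x, Q (n + 1) x = x → Q n x = x) ∧ (∀ n x, T x = x → Q n x = x) ∧
      (∀ x, (∀ n, Q n x = x) → T x = x) ∧
      ∀ n, ∃ δ > 0, ∀ x, Q n x = 0 → δ * ‖x‖ ^ 2 ≤ re ⟪(1 - T) x, x⟫ := by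
  obtain ⟨D, hDdef⟩ : ∃ D, D = 1 - T := ⟨_, rfl⟩
  have hTB : T ∈ B := hAB T hTA
  have hDB : D ∈ B := hDdef ▸ sub_mem (one_mem B) hTB
  have hD : IsSelfAdjoint D := hDdef ▸ (IsSelfAdjoint.one _).sub hT
  -- The bound `t ≤ 1/8` yields `‖D Qₙ‖² ≤ 2 · (1/8) = 1/4`, which is what places `Qₙ` in `A`.
  obtain ⟨t, ht⟩ : ∃ t : ℕ → ℝ, ∀ n, t n = (1 / 8) * (1 / 2) ^ n := ⟨_, fun _ => rfl⟩
  have ht0 : ∀ n, 0 < t n := fun n => by rw [ht]; positivity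
  have hta : StrictAnti t := by
    refine strictAnti_nat_of_succ_lt fun n => ?_
    have := ht0 n
    rw [ht, pow_succ, ← mul_assoc, ← ht]
    linarith
  have ht8 : ∀ n, t n ≤ 1 / 8 := fun n => by
    rw [ht]
    have : ((1 : ℝ) / 2) ^ n ≤ 1 := pow_le_one₀ (by norm_num) (by norm_num)
    linarith
  obtain ⟨u, huB, husa, hus, hux, hule, huge⟩ := exists_cutoffs B hB hDB hD t hta ht0
  have hlt : ∀ i j, i < j → u i * u j = u j := by
    intro i j hij
    induction j, hij using Nat.le_induction with
    | base => exact hus i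
    | succ j hj ih => rw [← hus j, ← mul_assoc, ih]
  have hgt : ∀ i j, i < j → u j * u i = u j := by
    intro i j hij
    have := congrArg star (hlt i j hij)
    rwa [star_mul, (husa i).star_eq, (husa j).star_eq] at this
  -- Three cutoffs per projection: `u (3n+3)` below, `1 - u (3n+1)` excluded, and `2 u (3n+2) - 1`
  -- separating them. Then `Qₙ` lies under `u (3n)`, so `Qₙ₊₁` lies under `u (3n+3)`, hence under
  -- `Qₙ`.
  have key : ∀ n, ∃ q ∈ B, IsStarProjection q ∧ (∀ x, u (3 * n + 3) x = x → q x = x) ∧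
      ∀ x, (1 - u (3 * n + 1)) x = x → q x = 0 := by
    intro n
    have h12 := hgt (3 * n + 1) (3 * n + 2) (by omega)
    have h23 := hlt (3 * n + 2) (3 * n + 3) (by omega)
    have h13 := hlt (3 * n + 1) (3 * n + 3) (by omega)
    refine exists_interpolation hB hd (h := u (3 * n + 2) + u (3 * n + 2) - 1)
      (sub_mem (add_mem (huB _) (huB _)) (one_mem B))
      (((husa _).add (husa _)).sub (IsSelfAdjoint.one _)) (huB _)
      (sub_mem (one_mem B) (huB _)) ((IsSelfAdjoint.one _).sub (husa _)) ?_ ?_ ?_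
    · rw [sub_mul, add_mul, h23, one_mul]; abel
    · rw [mul_sub, mul_one, sub_mul, add_mul, h12, one_mul]; abel
    · rw [sub_mul, one_mul, h13, sub_self]
  choose Q hQB hQ hQc hQd using key
  have hQQ : ∀ n, Q n * Q n = Q n := fun n => (hQ n).isIdempotentElem
  have hQu : ∀ n, Q n * u (3 * n) = Q n := by
    intro n
    have : Q n * (1 - u (3 * n)) = 0 := by
      ext x
      refine hQd n ((1 - u (3 * n)) x) ?_
      change ((1 - u (3 * n + 1)) * (1 - u (3 * n))) x = _
      rw [mul_sub, mul_one, sub_mul, one_mul, hgt _ _ (Nat.lt_succ_self _)]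
      simp
    rw [mul_sub, mul_one, sub_eq_zero] at this
    exact this.symm
  have huQ : ∀ n, u (3 * n) * Q n = Q n := by
    intro n
    have := congrArg star (hQu n)
    rwa [star_mul, (husa _).star_eq, (hQ n).isSelfAdjoint.star_eq] at this
  have huQx : ∀ n x, Q n x = x → u (3 * n) x = x := by
    intro n x hx
    have := congrArg (fun z : H →L[𝕜] H => z x) (huQ n)
    have h2 : u (3 * n) (Q n x) = Q n x := this
    rwa [hx] at h2
  have hle : ∀ n x, Q n x = x → re ⟪D x, x⟫ ≤ t (3 * n) * ‖x‖ ^ 2 := fun n x hx =>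
    hule _ x (huQx n x hx)
  have hQA : ∀ n, Q n ∈ A := by
    intro n
    have hDQ : ‖D * Q n‖ ≤ 1 / 2 := by
      refine ContinuousLinearMap.opNorm_le_bound _ (by norm_num) fun x => ?_
      have h1 : Q n (Q n x) = Q n x := congrArg (fun z : H →L[𝕜] H => z x) (hQQ n)
      have h2 := hle n (Q n x) h1
      have h3 := norm_one_sub_apply_sq_le hT1 (Q n x)
      rw [← hDdef] at h3
      have h4 : ‖Q n x‖ ≤ ‖x‖ := by
        simpa using ((Q n).le_opNorm x).trans
          (mul_le_mul_of_nonneg_right (hQ n).norm_le (norm_nonneg _))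
      have h5 := ht8 (3 * n)
      refine le_of_sq_le_sq ?_ (by positivity)
      change ‖D (Q n x)‖ ^ 2 ≤ _
      have h6 : ‖Q n x‖ ^ 2 ≤ ‖x‖ ^ 2 := by gcongr
      have h7 : t (3 * n) * ‖Q n x‖ ^ 2 ≤ 1 / 8 * ‖Q n x‖ ^ 2 := by gcongr
      nlinarith
    have hQD : ‖Q n * D‖ < 1 := by
      rw [← norm_star, star_mul, hD.star_eq, (hQ n).isSelfAdjoint.star_eq]
      linarith
    have hMB : (∑' k : ℕ, (Q n * D) ^ k) ∈ B :=
      tsum_mem (s := B) hB fun k => pow_mem (mul_mem (hQB n) hDB) k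
    have h1 : (1 - Q n * D) * Q n = Q n * T * Q n := by
      rw [hDdef, mul_sub, mul_one, sub_mul, sub_mul, one_mul, hQQ]; abel
    -- `1 - Qₙ D` is invertible in `B` and maps `Qₙ` to `Qₙ T Qₙ`. As `A` absorbs left
    -- multiplication by `B`, inverting it puts `Qₙ` in `A`.
    have h2 : Q n = (∑' k : ℕ, (Q n * D) ^ k) * Q n * T * Q n := by
      rw [mul_assoc _ (Q n), mul_assoc _ (Q n * T), ← h1, ← mul_assoc,
        geom_series_mul_neg _ hQD, one_mul]
    have h3 : Q n * T ∈ A := hl _ (hQB n) _ hTA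
    have h4 : T * Q n ∈ A := by
      have := star_mem h3
      rwa [star_mul, hT.star_eq, (hQ n).isSelfAdjoint.star_eq] at this
    rw [h2, mul_assoc]
    exact hl _ (mul_mem hMB (hQB n)) _ h4
  refine ⟨Q, hQA, hQ, fun n x hx => ?_, fun n x hx => ?_, fun x hx => ?_, fun n => ?_⟩
  · refine hQc n x ?_
    exact huQx (n + 1) x hx
  · refine hQc n x (hux _ x ?_)
    rw [hDdef]
    change x - T x = 0
    rw [hx, sub_self]
  · have htend : Tendsto (fun n => t (3 * n) * ‖x‖ ^ 2) atTop (𝓝 (0 * ‖x‖ ^ 2)) := by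
      refine Tendsto.mul_const _ ?_
      have h1 : Tendsto t atTop (𝓝 0) := by
        have h2 := (tendsto_pow_atTop_nhds_zero_of_lt_one (r := (1 / 2 : ℝ)) (by norm_num)
          (by norm_num)).const_mul (1 / 8)
        rw [mul_zero] at h2
        exact h2.congr fun n => (ht n).symm
      exact h1.comp (tendsto_id.const_mul_atTop' (by norm_num))
    have h1 : re ⟪D x, x⟫ ≤ 0 := by
      rw [zero_mul] at htend
      exact ge_of_tendsto htend (Eventually.of_forall fun n => hle n x (hx n))
    have h3 := norm_one_sub_apply_sq_le hT1 x
    rw [← hDdef] at h3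
    have h4 : ‖D x‖ ^ 2 = 0 := le_antisymm (by linarith) (sq_nonneg _)
    have h5 : D x = 0 := norm_eq_zero.1 (pow_eq_zero_iff two_ne_zero |>.1 h4)
    rw [hDdef] at h5
    exact (sub_eq_zero.1 h5).symm
  -- `Qₙ` is the identity on the range of `u (3n+4)`, so `Qₙ x = 0` forces `u (3n+4) x = 0`; the
  -- lower bound then has the next threshold.
  · refine ⟨t (3 * n + 4 + 1), ht0 _, fun x hx => ?_⟩
    rw [← hDdef]
    refine huge _ x ?_
    have h1 : Q n * u (3 * n + 4) = u (3 * n + 4) := by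
      ext y
      refine hQc n (u (3 * n + 4) y) ?_
      change (u (3 * n + 3) * u (3 * n + 4)) y = _
      rw [hlt _ _ (by omega)]
    have h2 := congrArg star h1
    rw [star_mul, (husa _).star_eq, (hQ n).isSelfAdjoint.star_eq] at h2
    rw [← h2]
    change u (3 * n + 4) (Q n x) = 0
    rw [hx, map_zero]

/-! ### Adjoining the identity operator. -/

/-- The operators `S + c • 1` with `S ∈ A`, as a unital star subalgebra. -/
def adjoinOneSubalgebra (A : NonUnitalStarSubalgebra 𝕜 (H →L[𝕜] H)) :
    StarSubalgebra 𝕜 (H →L[𝕜] H) where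
  carrier := adjoinOne A
  mul_mem' := by
    rintro _ _ ⟨S, hS, c, rfl⟩ ⟨T, hT, d, rfl⟩
    refine ⟨S * T + d • S + c • T, add_mem (add_mem (mul_mem hS hT) (SMulMemClass.smul_mem d hS))
      (SMulMemClass.smul_mem c hT), c * d, ?_⟩
    rw [add_mul, mul_add, mul_add, smul_mul_smul_comm, mul_smul_comm, smul_mul_assoc, mul_one,
      one_mul, mul_one]
    abel
  add_mem' := by
    rintro _ _ ⟨S, hS, c, rfl⟩ ⟨T, hT, d, rfl⟩
    exact ⟨S + T, add_mem hS hT, c + d, by rw [add_smul]; abel⟩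
  algebraMap_mem' c := ⟨0, zero_mem A, c, by rw [zero_add, Algebra.algebraMap_eq_smul_one]⟩
  star_mem' := by
    rintro _ ⟨S, hS, c, rfl⟩
    exact ⟨star S, star_mem hS, star c, by rw [star_add, star_smul, star_one]⟩

theorem mem_adjoinOneSubalgebra {A : NonUnitalStarSubalgebra 𝕜 (H →L[𝕜] H)} {T : H →L[𝕜] H} :
    T ∈ adjoinOneSubalgebra A ↔ ∃ S ∈ A, ∃ c : 𝕜, T = S + c • (1 : H →L[𝕜] H) := Iff.rfl

/-- A closed subspace plus a finite-dimensional one is closed. -/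
theorem isClosed_adjoinOneSubalgebra {A : NonUnitalStarSubalgebra 𝕜 (H →L[𝕜] H)}
    (hA : IsClosed (A : Set (H →L[𝕜] H))) :
    IsClosed (adjoinOneSubalgebra A : Set (H →L[𝕜] H)) := by
  let s : Submodule 𝕜 (H →L[𝕜] H) := A.toSubmodule
  let t : Submodule 𝕜 (H →L[𝕜] H) := Submodule.span 𝕜 {1}
  have h := Submodule.isClosed_sup_finiteDimensional s t hA
  convert h using 1
  ext T
  change T ∈ adjoinOneSubalgebra A ↔ T ∈ s ⊔ t
  rw [mem_adjoinOneSubalgebra, Submodule.mem_sup]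
  constructor
  · rintro ⟨S, hS, c, rfl⟩
    exact ⟨S, hS, c • 1, Submodule.smul_mem _ _ (Submodule.mem_span_singleton_self _), rfl⟩
  · rintro ⟨S, hS, y, hy, rfl⟩
    obtain ⟨c, rfl⟩ := Submodule.mem_span_singleton.1 hy
    exact ⟨S, hS, c, rfl⟩

theorem IsUnitOf.isSelfAdjoint {A : NonUnitalStarSubalgebra 𝕜 (H →L[𝕜] H)} {e : H →L[𝕜] H}
    (he : IsUnitOf A e) : IsSelfAdjoint e := by
  have h1 := (he.2 (star e) (star_mem he.1)).2
  have h2 := congrArg star h1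
  rw [star_mul, star_star, h1] at h2
  exact h2

/-- Real rank zero passes to the algebra generated by `A` and the identity operator, also when `A`
has a unit other than the identity operator. -/
theorem invertiblesApproximate_adjoinOneSubalgebra {A : NonUnitalStarSubalgebra 𝕜 (H →L[𝕜] H)}
    (hrr : IsRealRankZero A) : InvertiblesApproximate (adjoinOneSubalgebra A) := by
  intro h hh hsa ε hε
  by_cases hu : ∃ e, IsUnitOf A e
  · obtain ⟨e, he⟩ := hu
    have hes := he.isSelfAdjoint
    have hee : e * e = e := (he.2 e he.1).1
    obtain ⟨S, hS, c, rfl⟩ := hh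
    have hS1 : S * (1 - e) = 0 := by rw [mul_sub, mul_one, (he.2 S hS).2, sub_self]
    have hS2 : (1 - e) * S = 0 := by rw [sub_mul, one_mul, (he.2 S hS).1, sub_self]
    have hff : (1 - e) * (1 - e) = 1 - e := by rw [mul_sub, mul_one, sub_mul, hee]; simp
    have hfs : IsSelfAdjoint (1 - e) := (IsSelfAdjoint.one _).sub hes
    -- Only `c • (1 - e)` is determined to be self-adjoint: if `e = 1`, the scalar `c` need not be
    -- real.
    have hcf : star c • (1 - e) = c • (1 - e) := by
      have h1 : (S + c • 1) * (1 - e) = c • (1 - e) := by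
        rw [add_mul, hS1, zero_add, smul_mul_assoc, one_mul]
      have h2 : (1 - e) * (S + c • 1) = c • (1 - e) := by
        rw [mul_add, hS2, zero_add, mul_smul_comm, mul_one]
      have h3 := congrArg star h1
      rw [star_mul, hsa.star_eq, hfs.star_eq, h2, star_smul, hfs.star_eq] at h3
      exact h3.symm
    have hre : ((re c : ℝ) : 𝕜) • (1 - e) = c • (1 - e) := by
      have : ((re c : ℝ) : 𝕜) = (2⁻¹ : 𝕜) * (c + star c) := by
        rw [RCLike.star_def, RCLike.add_conj]; simp
      rw [this, mul_smul, add_smul, hcf, ← two_smul 𝕜, smul_smul]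
      simp
    have hSe : S + c • 1 = (S + c • e) + ((re c : ℝ) : 𝕜) • (1 - e) := by
      rw [hre, smul_sub]; abel
    have haA : S + c • e ∈ A := add_mem hS (SMulMemClass.smul_mem c he.1)
    have hasa : IsSelfAdjoint (S + c • e) := by
      have : S + c • e = (S + c • 1) - ((re c : ℝ) : 𝕜) • (1 - e) := by rw [hSe]; abel
      rw [this]
      exact hsa.sub (isSelfAdjoint_ofReal_smul hfs _)
    obtain ⟨a, ⟨⟨haA', hasa'⟩, a', ha'A, haa', ha'a⟩, hdist⟩ :=
      Metric.mem_closure_iff.1 (hrr.1 e he ⟨haA, hasa⟩) (ε / 2) (by positivity)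
    -- The complementary corner is scalar, so a nonzero scalar near `re c` makes that block
    -- invertible.
    obtain ⟨ρ, hρ0, hρ⟩ : ∃ ρ : ℝ, ρ ≠ 0 ∧ |ρ - re c| ≤ ε / 4 := by
      by_cases hc : re c = 0
      · exact ⟨ε / 4, by positivity, by rw [hc, sub_zero, abs_of_pos (by positivity)]⟩
      · exact ⟨re c, hc, by rw [sub_self, abs_zero]; positivity⟩
    have hρ' : (ρ : 𝕜) ≠ 0 := by exact_mod_cast hρ0
    have hmem : ∀ b ∈ A, ∀ k : 𝕜, b + k • (1 - e) ∈ adjoinOneSubalgebra A := fun b hb k =>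
      ⟨b - k • e, sub_mem hb (SMulMemClass.smul_mem k he.1), k, by rw [smul_sub]; abel⟩
    have hprod : ∀ b ∈ A, ∀ b' ∈ A, ∀ k k' : 𝕜, b * b' = e → k * k' = 1 →
        (b + k • (1 - e)) * (b' + k' • (1 - e)) = 1 := by
      intro b hb b' hb' k k' hbb hkk
      have h1 : b * (1 - e) = 0 := by rw [mul_sub, mul_one, (he.2 b hb).2, sub_self]
      have h2 : (1 - e) * b' = 0 := by rw [sub_mul, one_mul, (he.2 b' hb').1, sub_self]
      rw [add_mul, mul_add, mul_add, smul_mul_smul_comm, mul_smul_comm, smul_mul_assoc, h1, h2,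
        hbb, hkk, hff]
      simp
    refine ⟨a + (ρ : 𝕜) • (1 - e), hmem a haA' _,
      hasa'.add (isSelfAdjoint_ofReal_smul hfs _),
      ⟨a' + (ρ : 𝕜)⁻¹ • (1 - e), hmem a' ha'A _,
        hprod a haA' a' ha'A _ _ haa' (mul_inv_cancel₀ hρ'),
        hprod a' ha'A a haA' _ _ ha'a (inv_mul_cancel₀ hρ')⟩, ?_⟩
    have hf1 : ‖1 - e‖ ≤ 1 := IsStarProjection.norm_le (1 - e) ⟨hff, hfs⟩
    have : a + (ρ : 𝕜) • (1 - e) - (S + c • 1) =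
        (a - (S + c • e)) + ((ρ - re c : ℝ) : 𝕜) • (1 - e) := by
      rw [hSe, RCLike.ofReal_sub, sub_smul]; abel
    rw [this]
    have h1 : ‖a - (S + c • e)‖ < ε / 2 := by rwa [dist_comm, dist_eq_norm] at hdist
    have h2 : ‖((ρ - re c : ℝ) : 𝕜) • (1 - e)‖ ≤ ε / 4 * 1 := by
      rw [norm_smul, RCLike.norm_ofReal]
      gcongr
    linarith [norm_add_le (a - (S + c • e)) (((ρ - re c : ℝ) : 𝕜) • (1 - e))]
  · obtain ⟨S, ⟨⟨hSB, hS⟩, S', hS'B, h1, h2⟩, hdist⟩ :=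
      Metric.mem_closure_iff.1 (hrr.2 hu ⟨hh, hsa⟩) ε hε
    exact ⟨S, hSB, hS, ⟨S', hS'B, h1, h2⟩, by rwa [dist_comm, dist_eq_norm] at hdist⟩

/-! ### The order of projections through fixed vectors. -/

theorem IsStarProjection.re_inner_apply_self {P : H →L[𝕜] H} (hP : IsStarProjection P) (x : H) :
    re ⟪P x, x⟫ = ‖P x‖ ^ 2 := by
  have h1 : P (P x) = P x := congrArg (fun z : H →L[𝕜] H => z x) hP.isIdempotentElem
  rw [← inner_self_eq_norm_sq (𝕜 := 𝕜), inner_apply_left_of_isSelfAdjoint hP.isSelfAdjoint x (P x),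
    h1, inner_re_symm]

theorem IsStarProjection.norm_apply_sq {P : H →L[𝕜] H} (hP : IsStarProjection P) (x : H) :
    ‖x - P x‖ ^ 2 = ‖x‖ ^ 2 - ‖P x‖ ^ 2 := by
  rw [norm_sub_apply_sq (𝕜 := 𝕜), IsStarProjection.re_inner_apply_self hP]
  ring

theorem IsStarProjection.mul_eq_of_forall {P Q : H →L[𝕜] H} (hP : IsStarProjection P)
    (hQ : IsStarProjection Q) (h : ∀ x, P x = x → Q x = x) : Q * P = P ∧ P * Q = P := by
  have hQP : Q * P = P := by
    ext x
    exact h _ (congrArg (fun z : H →L[𝕜] H => z x) hP.isIdempotentElem)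
  refine ⟨hQP, ?_⟩
  have := congrArg star hQP
  rwa [star_mul, hP.isSelfAdjoint.star_eq, hQ.isSelfAdjoint.star_eq] at this

theorem IsStarProjection.sub_of_forall {P Q : H →L[𝕜] H} (hP : IsStarProjection P)
    (hQ : IsStarProjection Q) (h : ∀ x, P x = x → Q x = x) : IsStarProjection (Q - P) := by
  obtain ⟨hQP, hPQ⟩ := IsStarProjection.mul_eq_of_forall hP hQ h
  refine ⟨?_, hQ.isSelfAdjoint.sub hP.isSelfAdjoint⟩
  change (Q - P) * (Q - P) = Q - P
  rw [mul_sub, sub_mul, sub_mul, hQP, hPQ, hQ.isIdempotentElem.eq, hP.isIdempotentElem.eq]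
  abel

/-- If `P x = x` and `P ≤ Q`, then `‖x‖² ≤ ⟪Q x, x⟫ = ‖Q x‖²`, so `x = Q x` by Pythagoras. -/
theorem IsStarProjection.le_iff_forall {P Q : H →L[𝕜] H} (hP : IsStarProjection P)
    (hQ : IsStarProjection Q) : P ≤ Q ↔ ∀ x, P x = x → Q x = x := by
  constructor
  · intro h x hx
    have h1 := (ContinuousLinearMap.le_def P Q).1 h |>.re_inner_nonneg_left x
    change 0 ≤ re ⟪Q x - P x, x⟫ at h1
    rw [inner_sub_left, map_sub, IsStarProjection.re_inner_apply_self hQ,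
      IsStarProjection.re_inner_apply_self hP, hx] at h1
    have h2 := IsStarProjection.norm_apply_sq hQ x
    have h3 : ‖x - Q x‖ ^ 2 = 0 := le_antisymm (by linarith) (sq_nonneg _)
    exact (sub_eq_zero.1 (norm_eq_zero.1 (pow_eq_zero_iff two_ne_zero |>.1 h3))).symm
  · intro h
    rw [ContinuousLinearMap.le_def]
    exact IsPositive.of_isStarProjection (IsStarProjection.sub_of_forall hP hQ h)

theorem Proj.le_iff {A : NonUnitalStarSubalgebra 𝕜 (H →L[𝕜] H)} {P Q : Proj A} :
    P ≤ Q ↔ ∀ x, P.1 x = x → Q.1 x = x :=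
  IsStarProjection.le_iff_forall P.2.2 Q.2.2

/-! ### Weighted averages and infima. -/

/-- The weighted average of a sequence of projections. -/
theorem exists_weightedAverage {A : NonUnitalStarSubalgebra 𝕜 (H →L[𝕜] H)}
    (hA : IsClosed (A : Set (H →L[𝕜] H))) (P : ℕ → Proj A) :
    ∃ T ∈ A, IsSelfAdjoint T ∧ ‖T‖ ≤ 1 ∧ (∀ x, T x = x ↔ ∀ n, (P n).1 x = x) ∧
      ∀ m x, (∀ n ≤ m, (P n).1 x = x) → re ⟪(1 - T) x, x⟫ ≤ (1 / 2) ^ (m + 1) * ‖x‖ ^ 2 := by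
  obtain ⟨a, ha⟩ : ∃ a : ℕ → ℝ, ∀ n, a n = 1 / 2 / 2 ^ n := ⟨_, fun _ => rfl⟩
  have ha0 : ∀ n, 0 < a n := fun n => by rw [ha]; positivity
  have hasum : HasSum a 1 := by
    rw [show a = fun n => 1 / 2 / 2 ^ n from funext ha]
    exact hasSum_geometric_two' 1
  let F : ℕ → (H →L[𝕜] H) := fun n => ((a n : ℝ) : 𝕜) • (P n).1
  have hFn : ∀ n, ‖F n‖ ≤ a n := fun n => by
    rw [norm_smul, RCLike.norm_ofReal, abs_of_pos (ha0 n)]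
    exact mul_le_of_le_one_right (ha0 n).le (P n).2.2.norm_le
  have hFs : Summable F := Summable.of_norm_bounded hasum.summable hFn
  have hFT : HasSum F (∑' n, F n) := hFs.hasSum
  obtain ⟨T, hTdef⟩ : ∃ T, T = ∑' n, F n := ⟨_, rfl⟩
  rw [← hTdef] at hFT
  have hTA : T ∈ A := hTdef ▸ tsum_mem (s := A) hA fun n => SMulMemClass.smul_mem _ (P n).2.1
  have hTsa : IsSelfAdjoint T := by
    have h1 : HasSum F (star T) := by
      have h2 := hFT.star
      have h3 : (fun n => star (F n)) = F := funext fun n =>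
        (isSelfAdjoint_ofReal_smul (P n).2.2.isSelfAdjoint (a n)).star_eq
      rwa [h3] at h2
    exact h1.unique hFT
  -- The weights sum to `1`, so the form of `1 - T` is a sum of nonnegative defects; it vanishes
  -- exactly when every `Pₙ` fixes `x`.
  have hTx : ∀ x, HasSum (fun n => a n * ‖x - (P n).1 x‖ ^ 2) (re ⟪(1 - T) x, x⟫) := by
    intro x
    have h1 : HasSum (fun n => F n x) (T x) :=
      hFT.mapL (ContinuousLinearMap.apply 𝕜 H x)
    have h2 : HasSum (fun n => re ⟪x, F n x⟫) (re ⟪x, T x⟫) :=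
      (h1.mapL (innerSL 𝕜 x)).mapL RCLike.reCLM
    have h3 := (hasum.mul_right (‖x‖ ^ 2)).sub h2
    rw [one_mul, ← inner_re_symm, ← re_inner_one_sub_apply] at h3
    refine h3.congr_fun fun n => ?_
    have h4 : re ⟪x, F n x⟫ = a n * ‖(P n).1 x‖ ^ 2 := by
      change re ⟪x, ((a n : ℝ) : 𝕜) • (P n).1 x⟫ = _
      rw [inner_smul_right, re_ofReal_mul, inner_re_symm,
        IsStarProjection.re_inner_apply_self (P n).2.2]
    rw [h4, IsStarProjection.norm_apply_sq (P n).2.2]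
    ring
  have hnn : ∀ x n, 0 ≤ a n * ‖x - (P n).1 x‖ ^ 2 := fun x n =>
    mul_nonneg (ha0 n).le (sq_nonneg _)
  have hT1 : ‖T‖ ≤ 1 := hTdef ▸ tsum_of_norm_bounded hasum hFn
  refine ⟨T, hTA, hTsa, hT1, fun x => ⟨fun hx n => ?_, fun hx => ?_⟩, fun m x hx => ?_⟩
  · have h0 : re ⟪(1 - T) x, x⟫ = 0 := by
      change re ⟪x - T x, x⟫ = 0
      rw [hx, sub_self, inner_zero_left, map_zero]
    have h1 := hTx x
    rw [h0] at h1
    have h2 := congrFun ((hasSum_zero_iff_of_nonneg (hnn x)).1 h1) n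
    have h3 : ‖x - (P n).1 x‖ ^ 2 = 0 := by
      simpa [(ha0 n).ne'] using h2
    exact (sub_eq_zero.1 (norm_eq_zero.1 (pow_eq_zero_iff two_ne_zero |>.1 h3))).symm
  · have h1 : re ⟪(1 - T) x, x⟫ = 0 := by
      refine (hTx x).unique ?_
      have : (fun n => a n * ‖x - (P n).1 x‖ ^ 2) = fun _ => 0 := by
        funext n; rw [hx n]; simp
      rw [this]
      exact hasSum_zero
    have h2 := norm_one_sub_apply_sq_le hT1 x
    have h4 : ‖(1 - T) x‖ ^ 2 = 0 := le_antisymm (by linarith) (sq_nonneg _)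
    exact (sub_eq_zero.1 (norm_eq_zero.1 (pow_eq_zero_iff two_ne_zero |>.1 h4))).symm
  · have hle : ∀ n, ‖x - (P n).1 x‖ ^ 2 ≤ ‖x‖ ^ 2 := fun n => by
      rw [IsStarProjection.norm_apply_sq (P n).2.2]
      linarith [sq_nonneg ‖(P n).1 x‖]
    -- The defects up to `m` vanish, and the remaining weights sum to `2⁻ᵐ⁻¹`.
    have h1 := (hasSum_nat_add_iff' (m + 1)).2 (hTx x)
    rw [Finset.sum_eq_zero (fun n hn => by
      rw [hx n (by have := Finset.mem_range.1 hn; omega)]; simp), sub_zero] at h1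
    have h2 : HasSum (fun n => a (n + (m + 1)) * ‖x‖ ^ 2) ((1 / 2) ^ (m + 1) * ‖x‖ ^ 2) := by
      have h3 := (hasum.mul_left ((1 / 2) ^ (m + 1))).mul_right (‖x‖ ^ 2)
      rw [mul_one] at h3
      refine h3.congr_fun fun n => ?_
      rw [ha, ha, pow_add (2 : ℝ), one_div_pow]
      field_simp
    exact hasSum_le (fun n => mul_le_mul_of_nonneg_left (hle _) (ha0 _).le) h1 h2

/-- In a `σ`-closed set of projections, a decreasing sequence with an infimum is eventually equal
to it. -/
theorem exists_eq_of_isGLB_of_antitone {A : NonUnitalStarSubalgebra 𝕜 (H →L[𝕜] H)}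
    (hσ : SigmaClosed (Proj A)) {Q : ℕ → Proj A} (hQ : Antitone Q) {G : Proj A}
    (hG : IsGLB (Set.range Q) G) : ∃ n, Q n = G := by
  by_contra! hne
  have hGQ : ∀ n x, G.1 x = x → (Q n).1 x = x := fun n =>
    Proj.le_iff.1 (hG.1 (Set.mem_range_self n))
  have hmul := fun n => IsStarProjection.mul_eq_of_forall G.2.2 (Q n).2.2 (hGQ n)
  let p : ℕ → Proj A := fun n => ⟨(Q n).1 - G.1, sub_mem (Q n).2.1 G.2.1,
    IsStarProjection.sub_of_forall G.2.2 (Q n).2.2 (hGQ n)⟩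
  have hGG : G.1 * G.1 = G.1 := G.2.2.isIdempotentElem
  have hp : ∀ n x, (p n).1 x = x ↔ (Q n).1 x = x ∧ G.1 x = 0 := by
    intro n x
    change (Q n).1 x - G.1 x = x ↔ _
    refine ⟨fun h => ?_, fun h => by rw [h.1, h.2, sub_zero]⟩
    have h1 : G.1 x = 0 := by
      rw [← h]
      change (G.1 * ((Q n).1 - G.1)) x = 0
      rw [mul_sub, (hmul n).2, hGG, sub_self]
      rfl
    rw [h1, sub_zero] at h
    exact ⟨h, h1⟩
  have hpa : Antitone p := fun i j hij => Proj.le_iff.2 fun x hx =>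
    (hp i x).2 ⟨Proj.le_iff.1 (hQ hij) x ((hp j x).1 hx).1, ((hp j x).1 hx).2⟩
  -- Such an `r` is orthogonal to `G` and below every `Qₙ`, so `r + G` is a lower bound; maximality
  -- of `G` then forces `r = 0`.
  obtain ⟨r, hr0, hr⟩ := hσ p hpa fun n h =>
    hne n (Subtype.ext (sub_eq_zero.1 (congrArg Subtype.val h)))
  have hrp : ∀ n x, r.1 x = x → (Q n).1 x = x ∧ G.1 x = 0 := fun n x hx =>
    (hp n x).1 (Proj.le_iff.1 (hr n) x hx)
  have hrr : r.1 * r.1 = r.1 := r.2.2.isIdempotentElem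
  have hrx : ∀ x, r.1 (r.1 x) = r.1 x := fun x => congrArg (fun z : H →L[𝕜] H => z x) hrr
  have hGr : G.1 * r.1 = 0 := by
    ext x
    exact (hrp 0 _ (hrx x)).2
  have hrG : r.1 * G.1 = 0 := by
    have := congrArg star hGr
    rwa [star_mul, r.2.2.isSelfAdjoint.star_eq, G.2.2.isSelfAdjoint.star_eq, star_zero] at this
  let s : Proj A := ⟨r.1 + G.1, add_mem r.2.1 G.2.1, by
    change (r.1 + G.1) * (r.1 + G.1) = _
    rw [add_mul, mul_add, mul_add, hGr, hrG, hrr, hGG, add_zero, zero_add],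
    r.2.2.isSelfAdjoint.add G.2.2.isSelfAdjoint⟩
  have hsG : s ≤ G := by
    refine hG.2 ?_
    rintro _ ⟨n, rfl⟩
    refine Proj.le_iff.2 fun x hx => ?_
    have hx : r.1 x + G.1 x = x := hx
    rw [← hx, map_add, (hrp n _ (hrx x)).1,
      hGQ n (G.1 x) (congrArg (fun z : H →L[𝕜] H => z x) hGG)]
  refine hr0 (Subtype.ext ?_)
  ext x
  have h1 := (hrp 0 _ (hrx x)).2
  have h2 : G.1 (r.1 x) = r.1 x := Proj.le_iff.1 hsG _ (by
    change r.1 (r.1 x) + G.1 (r.1 x) = _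
    rw [hrx, h1, add_zero])
  exact h2.symm.trans h1

/-- The projection onto the common fixed vectors is the infimum among all projections. -/
theorem isGLB_of_forall_iff {ι : Type*}
    (P : ι → Proj (⊤ : NonUnitalStarSubalgebra 𝕜 (H →L[𝕜] H)))
    {R : Proj (⊤ : NonUnitalStarSubalgebra 𝕜 (H →L[𝕜] H))} (s : Set ι)
    (h : ∀ x, R.1 x = x ↔ ∀ i ∈ s, (P i).1 x = x) : IsGLB (P '' s) R := by
  refine ⟨?_, fun L hL => ?_⟩
  · rintro _ ⟨i, hi, rfl⟩
    exact Proj.le_iff.2 fun x hx => (h x).1 hx i hi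
  · exact Proj.le_iff.2 fun x hx => (h x).2 fun i hi =>
      Proj.le_iff.1 (hL ⟨i, hi, rfl⟩) x hx

end RealRankZero

/-! ### The main theorem. -/

open RealRankZero in
theorem mainTheorem2 {𝕜 : Type*} [RCLike 𝕜] {H : Type*} [NormedAddCommGroup H]
    [InnerProductSpace 𝕜 H] [CompleteSpace H]
    (A : NonUnitalStarSubalgebra 𝕜 (H →L[𝕜] H)) (hA : IsClosed (A : Set (H →L[𝕜] H)))
    (hrr : IsRealRankZero A) (P : ℕ → Proj A) :
    (∃ Q : ℕ → Proj A, Antitone Q ∧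
      (∃ R : Proj (⊤ : NonUnitalStarSubalgebra 𝕜 (H →L[𝕜] H)),
        IsGLB (Set.range fun n => (P n).toAll) R ∧ IsGLB (Set.range fun n => (Q n).toAll) R) ∧
      lowerBounds (Set.range P) = lowerBounds (Set.range Q)) ∧
    (SigmaClosed (Proj A) → ∀ Q : Proj A, IsGLB (Set.range P) Q →
      ∃ m : ℕ, IsGLB ((fun n => (P n).toAll) '' Set.Iic m) Q.toAll) := by
  obtain ⟨T, hTA, hTsa, hT1, hTP, hTm⟩ := exists_weightedAverage hA P
  have hmem : ∀ b ∈ adjoinOneSubalgebra A, ∀ a ∈ A, b * a ∈ A := by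
    rintro _ ⟨S, hS, c, rfl⟩ a ha
    rw [add_mul, smul_mul_assoc, one_mul]
    exact add_mem (mul_mem hS ha) (SMulMemClass.smul_mem c ha)
  obtain ⟨Q', hQA, hQp, hQa, hTQ, hQT, hδ⟩ := exists_antitone_projections A
    (isClosed_adjoinOneSubalgebra hA) (invertiblesApproximate_adjoinOneSubalgebra hrr)
    (fun a ha => ⟨a, ha, 0, by rw [zero_smul, add_zero]⟩) hmem hTA hTsa hT1
  let Q : ℕ → Proj A := fun n => ⟨Q' n, hQA n, hQp n⟩
  have hQanti : Antitone Q := antitone_nat_of_succ_le fun n => Proj.le_iff.2 (hQa n)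
  have hPQ : ∀ x, (∀ n, (P n).1 x = x) ↔ ∀ n, (Q n).1 x = x := fun x =>
    ⟨fun h n => hTQ n x ((hTP x).2 h), fun h => (hTP x).1 (hQT x h)⟩
  have hlb : lowerBounds (Set.range P) = lowerBounds (Set.range Q) := by
    ext L
    simp only [mem_lowerBounds, Set.forall_mem_range, Proj.le_iff]
    constructor
    · exact fun h n x hx => (hPQ x).1 (fun k => h k x hx) n
    · exact fun h n x hx => (hPQ x).2 (fun k => h k x hx) n
  refine ⟨⟨Q, hQanti, ?_, hlb⟩, fun hσ G hG => ?_⟩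
  · let K : Submodule 𝕜 H := LinearMap.ker ((1 - T : H →L[𝕜] H) : H →ₗ[𝕜] H)
    have hK : IsClosed (K : Set H) := (1 - T : H →L[𝕜] H).isClosed_ker
    have : CompleteSpace K := hK.completeSpace_coe
    let R : Proj (⊤ : NonUnitalStarSubalgebra 𝕜 (H →L[𝕜] H)) :=
      ⟨K.starProjection, NonUnitalStarAlgebra.mem_top, isStarProjection_starProjection⟩
    have hR : ∀ x, R.1 x = x ↔ ∀ n, (P n).1 x = x := fun x => by
      rw [← hTP]
      change K.starProjection x = x ↔ _
      rw [Submodule.starProjection_eq_self_iff]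
      change x - T x = 0 ↔ _
      rw [sub_eq_zero, eq_comm]
    refine ⟨R, ?_, ?_⟩
    · rw [← Set.image_univ]
      exact isGLB_of_forall_iff _ _ fun x =>
        (hR x).trans ⟨fun h n _ => h n, fun h n => h n trivial⟩
    · rw [← Set.image_univ]
      exact isGLB_of_forall_iff _ _ fun x =>
        ((hR x).trans (hPQ x)).trans ⟨fun h n _ => h n, fun h n => h n trivial⟩
  · have hGQ : IsGLB (Set.range Q) G := by rwa [IsGLB, ← hlb]
    obtain ⟨n, hn⟩ := exists_eq_of_isGLB_of_antitone hσ hQanti hGQ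
    obtain ⟨δ, hδ0, hδn⟩ := hδ n
    have hQG : Q' n = G.1 := congrArg Subtype.val hn
    rw [hQG] at hδn
    obtain ⟨m, hm⟩ := exists_pow_lt_of_lt_one hδ0 (show (1 / 2 : ℝ) < 1 by norm_num)
    refine ⟨m, isGLB_of_forall_iff _ _ fun x => ⟨fun hx i _ => ?_, fun hx => ?_⟩⟩
    · exact Proj.le_iff.1 (hG.1 (Set.mem_range_self i)) x hx
    · have hx : ∀ i ≤ m, (P i).1 x = x := fun i hi => hx i hi
      have hGx : G.1 (G.1 x) = G.1 x :=
        congrArg (fun z : H →L[𝕜] H => z x) G.2.2.isIdempotentElem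
      -- `x - G x` is fixed by `P₀, …, Pₘ` and killed by `G = Qₙ`, so `δ ‖x - G x‖² ≤ 2⁻ᵐ⁻¹ ‖x - G
      -- x‖²` although `2⁻ᵐ < δ`.
      have h1 := hTm m (x - G.1 x) fun i hi => by
        rw [map_sub, hx i hi, Proj.le_iff.1 (hG.1 (Set.mem_range_self i)) _ hGx]
      have h2 := hδn (x - G.1 x) (by rw [map_sub, hGx, sub_self])
      have h3 : (1 / 2 : ℝ) ^ (m + 1) ≤ (1 / 2) ^ m :=
        pow_le_pow_of_le_one (by norm_num) (by norm_num) (Nat.le_succ m)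
      have h4 : ‖x - G.1 x‖ ^ 2 = 0 := by nlinarith [sq_nonneg ‖x - G.1 x‖]
      exact (sub_eq_zero.1 (norm_eq_zero.1 (pow_eq_zero_iff two_ne_zero |>.1 h4))).symm
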